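/- Let $k\ge 3$ and let $2\le n_1\le n_2\le\dots\le n_k$ be integers. The $n_1\times\dots\times n_k$ chessboard is the graph whose vertices are the points of $\{1,\dots,n_1\}\times\dots\times\{1,\dots,n_k\}$, two points being adjacent if and only if their difference is a knight move, that is, a vector in $\mathbb{Z}^k$ with exactly one entry in $\{1,-1\}$, exactly one entry in $\{2,-2\}$, and all the other $k-2$ entries equal to $0$. A closed knight tour is a Hamiltonian cycle of this graph. Then the $n_1\times\dots\times n_k$ chessboard has no closed knight tour if and only if at least one of the following holds: (a) $n_i$ is odd for all $i$; (b) $n_{k-1}=2$; (c) $n_k=3$. -/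

import Mathlib

/-- The knight moves in dimension `k`: integer vectors with exactly one entry `±1`, exactly one
entry `±2`, and all the other `k - 2` entries equal to `0`. -/
def knightMoves (k : ℕ) : Set (Fin k → ℤ) :=
  {a | Finset.card {i | a i = 0} + 2 = k ∧
    Finset.card {i | a i = 1 ∨ a i = -1} = 1 ∧
    Finset.card {i | a i = 2 ∨ a i = -2} = 1}

/-- The squares of the `n 0 × ⋯ × n (k - 1)` chessboard. The `i`-th coordinate runs over
`0, …, n i - 1`. -/
abbrev Board {k : ℕ} (n : Fin k → ℕ) : Type := (i : Fin k) → Fin (n i)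

/-- The knight graph of the `n 0 × ⋯ × n (k - 1)` chessboard: two squares are adjacent when
their difference is a knight move. -/
def knightGraph {k : ℕ} (n : Fin k → ℕ) : SimpleGraph (Board n) where
  Adj a b := (fun i => ((a i : ℕ) : ℤ) - ((b i : ℕ) : ℤ)) ∈ knightMoves k
  symm := ⟨fun a b h => by
    obtain ⟨h0, h1, h2⟩ := h
    refine ⟨?_, ?_, ?_⟩
    · refine Eq.trans ?_ h0
      congr 2
      ext i
      simp only [Finset.mem_filter, Finset.mem_univ, true_and]
      omega
    · refine Eq.trans ?_ h1
      congr 1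
      ext i
      simp only [Finset.mem_filter, Finset.mem_univ, true_and]
      omega
    · refine Eq.trans ?_ h2
      congr 1
      ext i
      simp only [Finset.mem_filter, Finset.mem_univ, true_and]
      omega⟩
  loopless := ⟨fun a h => by
    have h1 := h.2.1
    simp at h1⟩

/-- A closed knight tour: a closed walk of knight moves that is a Hamiltonian cycle of the
knight graph. -/
def HasClosedTour {k : ℕ} (n : Fin k → ℕ) : Prop :=
  ∃ (a : Board n) (p : (knightGraph n).Walk a a), p.IsHamiltonianCycle

/-!
There is no closed tour in the three exceptional cases for simple reasons. A knight move changes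
the parity of the coordinate sum, so the number of squares must be even
(`HasClosedTour.exists_even`). If all sides but the longest are `2`, every move changes the last
coordinate by `±2` and preserves its parity (`not_hasClosedTour_of_le_two`). If no side exceeds
`3`, the square with all coordinates equal to `1` admits no move
(`not_hasClosedTour_of_le_three`).

Otherwise tours are built by gluing. Two disjoint cycles merge into one when an edge `s(x, y)` of
the first and an edge `s(x', y')` of the second are exchanged for `s(x, x')` and `s(y, y')`
(`Tour.glue`), and all the other edges survive. In dimension three, tours are required to contain
the eight edges `cornerEdges`, chosen so that two boards with the same cross-section can be glued
in any direction and the result contains the corresponding eight edges again. Nine explicit tours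
then generate all boards `a × b × c` with `c` even, `a, b ≥ 3` and one side at least `4`
(`seeded_even`).

A new direction of length `m ≥ 2` is added by gluing `m` copies of a board. This needs a pair of
edges whose corresponding ends differ by `±2` in one coordinate, because such an edge of one copy
and its partner in the next are joined by knight moves. With two disjoint pairs available, one is
used for gluing while the other survives in every copy, so that there are again two disjoint pairs
(`Extendable.update`). Every non-exceptional board has three sides of the kind treated in
dimension three, and the remaining directions are added one at a time.
-/

/-! ### Closed tours as cyclic lists -/

/-- The edges joining consecutive entries of a list. -/
def pathEdges {V : Type*} : List V → List (Sym2 V)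
  | a :: b :: l => s(a, b) :: pathEdges (b :: l)
  | _ => []

/-- The edges of the cyclic list `l`: those of the path `l`, and the one joining the last entry
to the first. -/
def cycleEdges {V : Type*} : List V → List (Sym2 V)
  | [] => []
  | a :: l => pathEdges (a :: l ++ [a])

/-- The set `S` of vertices of `G` carries a closed tour, that is, a cyclic list of its elements,
each occurring once, with consecutive ones adjacent, and this tour uses all the edges in `F`. -/
def Tour {V : Type*} (G : SimpleGraph V) (S : Set V) (F : Set (Sym2 V)) : Prop :=
  ∃ l : List V, l.Nodup ∧ (∀ v, v ∈ l ↔ v ∈ S) ∧ (∀ e ∈ cycleEdges l, e ∈ G.edgeSet) ∧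
    ∀ e ∈ F, e ∈ cycleEdges l

section Lists

variable {V W : Type*}

theorem pathEdges_append (l : List V) (a : V) (m : List V) :
    pathEdges (l ++ a :: m) = pathEdges (l ++ [a]) ++ pathEdges (a :: m) := by
  induction l with
  | nil => simp [pathEdges]
  | cons b l ih =>
    cases l with
    | nil => simp [pathEdges]
    | cons c l => simpa [pathEdges] using ih

theorem pathEdges_reverse (l : List V) : pathEdges l.reverse = (pathEdges l).reverse := by
  induction l with
  | nil => rfl
  | cons a l ih =>
    cases l with
    | nil => rfl
    | cons b l =>
      have h : (a :: b :: l).reverse = l.reverse ++ b :: [a] := by simp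
      rw [h, pathEdges_append, ← List.reverse_cons, ih]
      simp [pathEdges, Sym2.eq_swap]

theorem pathEdges_map (f : V → W) (l : List V) :
    pathEdges (l.map f) = (pathEdges l).map (Sym2.map f) := by
  induction l with
  | nil => rfl
  | cons a l ih =>
    cases l with
    | nil => rfl
    | cons b l => simpa [pathEdges] using ih

theorem cycleEdges_map (f : V → W) (l : List V) :
    cycleEdges (l.map f) = (cycleEdges l).map (Sym2.map f) := by
  cases l with
  | nil => rfl
  | cons a l => simp [cycleEdges, ← pathEdges_map]

theorem mem_pathEdges {e : Sym2 V} {l : List V} (h : e ∈ pathEdges l) :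
    ∃ u x y v, l = u ++ x :: y :: v ∧ e = s(x, y) := by
  induction l with
  | nil => simp [pathEdges] at h
  | cons a l ih =>
    cases l with
    | nil => simp [pathEdges] at h
    | cons b l =>
      rw [pathEdges, List.mem_cons] at h
      rcases h with rfl | h
      · exact ⟨[], a, b, l, rfl, rfl⟩
      · obtain ⟨u, x, y, v, hl, he⟩ := ih h
        exact ⟨a :: u, x, y, v, by simp [hl], he⟩

theorem mem_of_mem_pathEdges {e : Sym2 V} {l : List V} (h : e ∈ pathEdges l) {v : V}
    (hv : v ∈ e) : v ∈ l := by
  obtain ⟨u, x, y, w, rfl, rfl⟩ := mem_pathEdges h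
  rcases Sym2.mem_iff.1 hv with rfl | rfl <;> simp

theorem mem_of_mem_cycleEdges {e : Sym2 V} {l : List V} (h : e ∈ cycleEdges l) {v : V}
    (hv : v ∈ e) : v ∈ l := by
  cases l with
  | nil => simp [cycleEdges] at h
  | cons a l => simpa [or_comm] using mem_of_mem_pathEdges h hv

/-- Removing the edge `s(x, y)` from a cycle leaves a path from `x` to `y`. -/
theorem exists_path_of_mem_cycleEdges {x y : V} {l : List V} (h : s(x, y) ∈ cycleEdges l) :
    ∃ l' : List V, l'.Perm l ∧ (∃ p, l' = x :: p) ∧ (∃ q, l' = q ++ [y]) ∧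
      ∀ e, e ∈ cycleEdges l ↔ e = s(x, y) ∨ e ∈ pathEdges l' := by
  -- The closed list splits at the edge; the two parts are exchanged.
  obtain ⟨x₀, y₀, he, l', hl, ⟨p, hp⟩, ⟨q, hq⟩, hE⟩ : ∃ x₀ y₀, s(x, y) = s(x₀, y₀) ∧
      ∃ l' : List V, l'.Perm l ∧ (∃ p, l' = y₀ :: p) ∧ (∃ q, l' = q ++ [x₀]) ∧
      ∀ e, e ∈ cycleEdges l ↔ e = s(x₀, y₀) ∨ e ∈ pathEdges l' := by
    cases l with
    | nil => simp [cycleEdges] at h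
    | cons a t =>
      obtain ⟨u, x₀, y₀, v, hl, he⟩ := mem_pathEdges h
      refine ⟨x₀, y₀, he, ?_⟩
      obtain ⟨z, hz⟩ : ∃ z, u ++ [x₀] = a :: z := by
        cases u with
        | nil => exact ⟨[], by simp_all⟩
        | cons b u => exact ⟨u ++ [x₀], by simp_all⟩
      obtain ⟨w, hw⟩ : ∃ w, y₀ :: v = w ++ [a] := by
        have h1 : (a :: t ++ [a]).getLast? = (u ++ x₀ :: y₀ :: v).getLast? := by rw [hl]
        refine ⟨(y₀ :: v).dropLast, ?_⟩
        have h2 : (y₀ :: v).getLast (by simp) = a := by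
          rw [List.getLast?_eq_some_getLast (by simp), List.getLast?_eq_some_getLast (by simp)] at h1
          simpa using h1.symm
        conv_lhs => rw [← List.dropLast_append_getLast (l := y₀ :: v) (by simp), h2]
      have ht : t = z ++ w := by
        have : u ++ x₀ :: y₀ :: v = (u ++ [x₀]) ++ (y₀ :: v) := by simp
        rw [this, hz, hw] at hl
        simpa [← List.append_assoc] using hl
      have hyp : w ++ a :: z = w ++ [a] ++ z := by simp
      refine ⟨w ++ a :: z, ?_, ⟨v ++ z, by rw [hyp, ← hw]; simp⟩, ⟨w ++ u, by rw [← hz]; simp⟩, ?_⟩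
      · rw [ht]
        exact (List.perm_append_comm (l₁ := w) (l₂ := a :: z))
      · intro e
        rw [cycleEdges, hl, pathEdges_append u, pathEdges_append w, hz, hw.symm, pathEdges]
        simp only [List.mem_append, List.mem_cons]
        tauto
  rcases Sym2.eq_iff.1 he with ⟨rfl, rfl⟩ | ⟨rfl, rfl⟩
  · refine ⟨l'.reverse, (List.reverse_perm _).trans hl, ⟨q.reverse, by simp [hq]⟩,
      ⟨p.reverse, by simp [hp]⟩, fun e => ?_⟩
    rw [hE, pathEdges_reverse, List.mem_reverse]
  · exact ⟨l', hl, ⟨p, hp⟩, ⟨q, hq⟩, fun e => by rw [hE, Sym2.eq_swap]⟩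

end Lists

section Tours

variable {V W : Type*} {G : SimpleGraph V} {H : SimpleGraph W} {S T : Set V} {F E : Set (Sym2 V)}

theorem Tour.mono (h : Tour G S F) (hE : E ⊆ F) : Tour G S E := by
  obtain ⟨l, h1, h2, h3, h4⟩ := h
  exact ⟨l, h1, h2, h3, fun e he => h4 e (hE he)⟩

theorem Tour.mem (h : Tour G S F) {e : Sym2 V} (he : e ∈ F) {v : V} (hv : v ∈ e) : v ∈ S := by
  obtain ⟨l, h1, h2, h3, h4⟩ := h
  exact (h2 v).1 (mem_of_mem_cycleEdges (h4 e he) hv)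

theorem Tour.map (h : Tour G S F) (f : V → W) (hf : Set.InjOn f S)
    (hadj : ∀ u ∈ S, ∀ v ∈ S, G.Adj u v → H.Adj (f u) (f v)) :
    Tour H (f '' S) (Sym2.map f '' F) := by
  obtain ⟨l, h1, h2, h3, h4⟩ := h
  refine ⟨l.map f, ?_, ?_, ?_, ?_⟩
  · exact h1.map_on fun x hx y hy hxy => hf ((h2 x).1 hx) ((h2 y).1 hy) hxy
  · intro w
    simp [h2]
  · intro e he
    rw [cycleEdges_map, List.mem_map] at he
    obtain ⟨e, he, rfl⟩ := he
    have hm := fun v => mem_of_mem_cycleEdges (v := v) he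
    have := h3 e he
    induction e with
    | _ x y =>
      exact hadj x ((h2 x).1 (hm x (by simp))) y ((h2 y).1 (hm y (by simp))) this
  · rintro _ ⟨e, he, rfl⟩
    rw [cycleEdges_map]
    exact List.mem_map_of_mem (h4 e he)

/-- Two disjoint tours merge into one: an edge `s(x, y)` of the first and an edge `s(x', y')` of
the second are exchanged for `s(x, x')` and `s(y, y')`. All the other edges survive. -/
theorem Tour.glue (h₁ : Tour G S F) (h₂ : Tour G T E) (hd : Disjoint S T) {x y x' y' : V}
    (he : s(x, y) ∈ F) (he' : s(x', y') ∈ E) (hx : G.Adj x x') (hy : G.Adj y y') :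
    Tour G (S ∪ T) ((F \ {s(x, y)}) ∪ (E \ {s(x', y')})) := by
  obtain ⟨l₁, nd₁, mem₁, adj₁, sub₁⟩ := h₁
  obtain ⟨l₂, nd₂, mem₂, adj₂, sub₂⟩ := h₂
  obtain ⟨m₁, perm₁, ⟨p₁, hp₁⟩, ⟨q₁, hq₁⟩, ed₁⟩ :=
    exists_path_of_mem_cycleEdges (Sym2.eq_swap ▸ sub₁ _ he : s(y, x) ∈ cycleEdges l₁)
  obtain ⟨m₂, perm₂, ⟨p₂, hp₂⟩, ⟨q₂, hq₂⟩, ed₂⟩ := exists_path_of_mem_cycleEdges (sub₂ _ he')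
  have key : ∀ e, e ∈ cycleEdges (m₁ ++ m₂) ↔
      e ∈ pathEdges m₁ ∨ e = s(x, x') ∨ e ∈ pathEdges m₂ ∨ e = s(y', y) := by
    intro e
    have h1 : cycleEdges (m₁ ++ m₂) = pathEdges (m₁ ++ m₂ ++ [y]) := by
      rw [hp₁]; simp [cycleEdges]
    have h2 : m₁ ++ m₂ ++ [y] = q₁ ++ x :: (m₂ ++ [y]) := by rw [hq₁]; simp
    have h3 : x :: (m₂ ++ [y]) = [x] ++ x' :: (p₂ ++ [y]) := by rw [hp₂]; simp
    have h4 : x' :: (p₂ ++ [y]) = q₂ ++ y' :: [y] := by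
      rw [← List.cons_append, ← hp₂, hq₂]; simp
    rw [h1, h2, pathEdges_append, ← hq₁, h3, pathEdges_append [x] x', h4,
      pathEdges_append q₂ y', ← hq₂]
    simp [pathEdges]
  refine ⟨m₁ ++ m₂, ?_, ?_, ?_, ?_⟩
  · refine (perm₁.nodup_iff.2 nd₁).append (perm₂.nodup_iff.2 nd₂) fun v hv hv' => ?_
    exact Set.disjoint_left.1 hd ((mem₁ v).1 (perm₁.mem_iff.1 hv))
      ((mem₂ v).1 (perm₂.mem_iff.1 hv'))
  · intro v
    rw [List.mem_append, perm₁.mem_iff, perm₂.mem_iff, mem₁, mem₂, Set.mem_union]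
  · intro e h
    rcases (key e).1 h with h | rfl | h | rfl
    · exact adj₁ e ((ed₁ e).2 (Or.inr h))
    · exact hx
    · exact adj₂ e ((ed₂ e).2 (Or.inr h))
    · exact hy.symm
  · rintro e (⟨h, hne⟩ | ⟨h, hne⟩)
    · refine (key e).2 (Or.inl (((ed₁ e).1 (sub₁ e h)).resolve_left ?_))
      rwa [Sym2.eq_swap]
    · exact (key e).2 (Or.inr (Or.inr (Or.inl (((ed₂ e).1 (sub₂ e h)).resolve_left hne))))

end Tours

/-! ### Boards of dimension three -/

/-- The knight graph on `ℤ³`. The squares `0`, `1`, `4` being the only ones up to `5`, three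
integers are `0`, `±1`, `±2` in some order exactly when their squares sum to `5`. -/
def spaceKnight : SimpleGraph (ℤ × ℤ × ℤ) where
  Adj u v := (u.1 - v.1) ^ 2 + (u.2.1 - v.2.1) ^ 2 + (u.2.2 - v.2.2) ^ 2 = 5
  symm := ⟨fun u v h => by rw [← h]; ring⟩
  loopless := ⟨fun u h => by simp at h⟩

instance : DecidableRel spaceKnight.Adj :=
  fun u v => inferInstanceAs
    (Decidable ((u.1 - v.1) ^ 2 + (u.2.1 - v.2.1) ^ 2 + (u.2.2 - v.2.2) ^ 2 = 5))

/-- The points of the `a × b × c` board, with coordinates starting from `0`. -/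
noncomputable def spaceBox (a b c : ℤ) : Finset (ℤ × ℤ × ℤ) :=
  Finset.Ico 0 a ×ˢ Finset.Ico 0 b ×ˢ Finset.Ico 0 c

/-- The edges demanded of a tour of the `a × b × c` board. The first four lie in the corner at the
origin; each of the others is at the far end of one of the directions, and can be exchanged
together with one of the first four when a second board is attached there. -/
def cornerEdges (a b c : ℤ) : List (Sym2 (ℤ × ℤ × ℤ)) :=
  [s((0, 0, 0), (1, 2, 0)), s((0, 2, 0), (1, 0, 0)), s((0, 0, 0), (2, 1, 0)),
    s((2, 0, 0), (0, 1, 0)), s((a - 2, 2, 1), (a - 1, 0, 1)), s((2, b - 2, 1), (0, b - 1, 1)),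
    s((0, 1, c - 1), (2, 0, c - 1)), s((1, 0, c - 1), (0, 2, c - 1))]

/-- The `a × b × c` board has a closed tour that uses the prescribed edges. -/
def Seeded (a b c : ℤ) : Prop :=
  Tour spaceKnight (spaceBox a b c) {e | e ∈ cornerEdges a b c}

theorem mem_spaceBox {a b c x y z : ℤ} : (x, y, z) ∈ spaceBox a b c ↔
    (0 ≤ x ∧ x < a) ∧ (0 ≤ y ∧ y < b) ∧ 0 ≤ z ∧ z < c := by
  simp [spaceBox]

theorem Seeded.swap {a b c : ℤ} (h : Seeded a b c) : Seeded b a c := by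
  have h1 := h.map (H := spaceKnight) (fun v => (v.2.1, v.1, v.2.2))
    (fun u _ v _ huv => by simp only [Prod.mk.injEq] at huv; ext <;> simp [huv])
    (fun u _ v _ huv => by
      change _ = _ at huv
      change _ = _
      rw [← huv]; ring)
  have h2 : (fun v : ℤ × ℤ × ℤ => (v.2.1, v.1, v.2.2)) '' (spaceBox a b c) = spaceBox b a c := by
    ext ⟨x, y, z⟩
    simp only [Set.mem_image, Finset.mem_coe, Prod.exists, mem_spaceBox, Prod.mk.injEq]
    constructor
    · rintro ⟨x, y, z, h, rfl, rfl, rfl⟩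
      tauto
    · exact fun h => ⟨y, x, z, by tauto, rfl, rfl, rfl⟩
  rw [h2] at h1
  refine h1.mono fun e he => ?_
  simp only [cornerEdges, Set.mem_ofPred_eq, List.mem_cons, List.not_mem_nil, or_false] at he
  simp only [cornerEdges, Set.mem_image, Set.mem_ofPred_eq, List.mem_cons, List.not_mem_nil,
    or_false]
  rcases he with rfl | rfl | rfl | rfl | rfl | rfl | rfl | rfl
  · exact ⟨s((0, 0, 0), (2, 1, 0)), by simp⟩
  · exact ⟨s((2, 0, 0), (0, 1, 0)), by simp⟩
  · exact ⟨s((0, 0, 0), (1, 2, 0)), by simp⟩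
  · exact ⟨s((0, 2, 0), (1, 0, 0)), by simp⟩
  · exact ⟨s((2, b - 2, 1), (0, b - 1, 1)), by simp⟩
  · exact ⟨s((a - 2, 2, 1), (a - 1, 0, 1)), by simp⟩
  · exact ⟨s((1, 0, c - 1), (0, 2, c - 1)), by simp⟩
  · exact ⟨s((0, 1, c - 1), (2, 0, c - 1)), by simp⟩

/-- Two boards that agree in all directions but the first can be joined along that one. -/
theorem Seeded.add_left {a₁ a₂ b c : ℤ} (h₁ : Seeded a₁ b c) (h₂ : Seeded a₂ b c)
    (ha₁ : 3 ≤ a₁) (ha₂ : 3 ≤ a₂) (hb : 3 ≤ b) : Seeded (a₁ + a₂) b c := by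
  have h3 := h₂.map (H := spaceKnight) (fun v => (a₁ + v.1, v.2.1, v.2.2))
    (fun u _ v _ huv => by
      simp only [Prod.mk.injEq, add_right_inj] at huv; ext <;> simp [huv])
    (fun u _ v _ huv => by
      change _ = _ at huv
      change _ = _
      rw [← huv]; ring)
  have hbox : (fun v : ℤ × ℤ × ℤ => (a₁ + v.1, v.2.1, v.2.2)) '' (spaceBox a₂ b c) =
      {v | v ∈ spaceBox (a₁ + a₂) b c ∧ a₁ ≤ v.1} := by
    ext ⟨x, y, z⟩
    simp only [Set.mem_image, Finset.mem_coe, Prod.exists, mem_spaceBox, Prod.mk.injEq,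
      Set.mem_ofPred_eq]
    constructor
    · rintro ⟨x, y, z, h, rfl, rfl, rfl⟩
      omega
    · exact fun h => ⟨x - a₁, y, z, by omega, by omega, rfl, rfl⟩
  rw [hbox] at h3
  have h4 := Tour.glue (x := (a₁ - 2, 2, 1)) (y := (a₁ - 1, 0, 1)) (x' := (a₁ + 0, 2, 0))
    (y' := (a₁ + 1, 0, 0)) h₁ h3 ?_ ?_ ?_ ?_ ?_
  · have hunion : (spaceBox a₁ b c : Set (ℤ × ℤ × ℤ)) ∪
        {v | v ∈ spaceBox (a₁ + a₂) b c ∧ a₁ ≤ v.1} = spaceBox (a₁ + a₂) b c := by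
      ext ⟨x, y, z⟩
      simp only [Set.mem_union, Finset.mem_coe, mem_spaceBox, Set.mem_ofPred_eq]
      omega
    rw [hunion] at h4
    refine h4.mono fun e he => ?_
    simp only [cornerEdges, Set.mem_ofPred_eq, List.mem_cons, List.not_mem_nil, or_false] at he
    rcases he with rfl | rfl | rfl | rfl | rfl | rfl | rfl | rfl
    on_goal 5 =>
      right
      refine ⟨⟨s((a₂ - 2, 2, 1), (a₂ - 1, 0, 1)), by simp [cornerEdges], ?_⟩, ?_⟩
      · simp only [Sym2.map_mk, add_sub_assoc]
      · simp
    all_goals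
      left
      refine ⟨by simp [cornerEdges], ?_⟩
      simp only [Set.mem_singleton_iff, Sym2.eq_iff, Prod.mk.injEq]
      omega
  · rw [Set.disjoint_left]
    rintro ⟨x, y, z⟩ hv ⟨_, hv'⟩
    rw [Finset.mem_coe, mem_spaceBox] at hv
    dsimp only at hv'
    omega
  · simp [cornerEdges]
  · exact ⟨s((0, 2, 0), (1, 0, 0)), by simp [cornerEdges], rfl⟩
  · change _ = _
    ring
  · change _ = _
    ring

theorem Seeded.add_right {a b₁ b₂ c : ℤ} (h₁ : Seeded a b₁ c) (h₂ : Seeded a b₂ c)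
    (ha : 3 ≤ a) (hb₁ : 3 ≤ b₁) (hb₂ : 3 ≤ b₂) : Seeded a (b₁ + b₂) c :=
  (h₁.swap.add_left h₂.swap hb₁ hb₂ ha).swap

/-- Two boards that agree in all directions but the last can be joined along that one. -/
theorem Seeded.add_height {a b c₁ c₂ : ℤ} (h₁ : Seeded a b c₁) (h₂ : Seeded a b c₂)
    (ha : 3 ≤ a) (hb : 3 ≤ b) (hc₁ : 2 ≤ c₁) (hc₂ : 2 ≤ c₂) : Seeded a b (c₁ + c₂) := by
  have h3 := h₂.map (H := spaceKnight) (fun v => (v.1, v.2.1, c₁ + v.2.2))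
    (fun u _ v _ huv => by
      simp only [Prod.mk.injEq, add_right_inj] at huv; ext <;> simp [huv])
    (fun u _ v _ huv => by
      change _ = _ at huv
      change _ = _
      rw [← huv]; ring)
  have hbox : (fun v : ℤ × ℤ × ℤ => (v.1, v.2.1, c₁ + v.2.2)) '' (spaceBox a b c₂) =
      {v | v ∈ spaceBox a b (c₁ + c₂) ∧ c₁ ≤ v.2.2} := by
    ext ⟨x, y, z⟩
    simp only [Set.mem_image, Finset.mem_coe, Prod.exists, mem_spaceBox, Prod.mk.injEq,
      Set.mem_ofPred_eq]
    constructor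
    · rintro ⟨x, y, z, h, rfl, rfl, rfl⟩
      omega
    · exact fun h => ⟨x, y, z - c₁, by omega, rfl, rfl, by omega⟩
  rw [hbox] at h3
  have h4 := Tour.glue (x := (0, 1, c₁ - 1)) (y := (2, 0, c₁ - 1)) (x' := (2, 1, c₁ + 0))
    (y' := (0, 0, c₁ + 0)) h₁ h3 ?_ ?_ ?_ ?_ ?_
  · have hunion : (spaceBox a b c₁ : Set (ℤ × ℤ × ℤ)) ∪
        {v | v ∈ spaceBox a b (c₁ + c₂) ∧ c₁ ≤ v.2.2} = spaceBox a b (c₁ + c₂) := by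
      ext ⟨x, y, z⟩
      simp only [Set.mem_union, Finset.mem_coe, mem_spaceBox, Set.mem_ofPred_eq]
      omega
    rw [hunion] at h4
    refine h4.mono fun e he => ?_
    simp only [cornerEdges, Set.mem_ofPred_eq, List.mem_cons, List.not_mem_nil, or_false] at he
    rcases he with rfl | rfl | rfl | rfl | rfl | rfl | rfl | rfl
    on_goal 7 =>
      right
      refine ⟨⟨s((0, 1, c₂ - 1), (2, 0, c₂ - 1)), by simp [cornerEdges], ?_⟩, ?_⟩
      · simp only [Sym2.map_mk, add_sub_assoc]
      · simp
    on_goal 7 =>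
      right
      refine ⟨⟨s((1, 0, c₂ - 1), (0, 2, c₂ - 1)), by simp [cornerEdges], ?_⟩, ?_⟩
      · simp only [Sym2.map_mk, add_sub_assoc]
      · simp
    all_goals
      left
      refine ⟨by simp [cornerEdges], ?_⟩
      simp only [Set.mem_singleton_iff, Sym2.eq_iff, Prod.mk.injEq]
      omega
  · rw [Set.disjoint_left]
    rintro ⟨x, y, z⟩ hv ⟨_, hv'⟩
    rw [Finset.mem_coe, mem_spaceBox] at hv
    dsimp only at hv'
    omega
  · simp [cornerEdges]
  · exact ⟨s((2, 1, 0), (0, 0, 0)), by simp [cornerEdges], rfl⟩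
  · change _ = _
    ring
  · change _ = _
    ring

/-! ### Explicit tours and the boards generated by them -/

/-- The list of points of `ℤ³` whose coordinates are the decimal digits of the given numbers. -/
def digitPoints (l : List ℕ) : List (ℤ × ℤ × ℤ) :=
  l.map fun n => ((n / 100 : ℕ), (n / 10 % 10 : ℕ), (n % 10 : ℕ))

/-- A cyclic list of points is a tour once it passes a finite verification. -/
theorem Seeded.of_list {a b c : ℤ} (l : List (ℤ × ℤ × ℤ)) (h : l.Nodup ∧
    l.toFinset = spaceBox a b c ∧ (∀ e ∈ cycleEdges l, e ∈ spaceKnight.edgeSet) ∧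
    ∀ e ∈ cornerEdges a b c, e ∈ cycleEdges l) : Seeded a b c :=
  ⟨l, h.1, fun v => by rw [← h.2.1]; simp, h.2.2⟩

theorem seeded_3_4_2 : Seeded 3 4 2 :=
  .of_list (digitPoints [
    000, 210, 231, 111, 130, 010, 200, 221, 031, 230, 110, 131, 211, 001, 020, 100, 121, 201,
    011, 030, 220, 021, 101, 120])
    (by decide +kernel)

theorem seeded_3_5_2 : Seeded 3 5 2 :=
  .of_list (digitPoints [
    000, 210, 130, 010, 200, 001, 211, 131, 011, 201, 121, 100, 020, 140, 220, 030, 110, 230,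
    040, 241, 031, 111, 231, 041, 240, 221, 141, 021, 101, 120])
    (by decide +kernel)

theorem seeded_3_6_2 : Seeded 3 6 2 :=
  .of_list (digitPoints [
    000, 210, 011, 201, 121, 100, 020, 140, 220, 010, 200, 001, 211, 131, 110, 230, 150, 030,
    051, 241, 040, 250, 130, 111, 231, 151, 031, 050, 251, 041, 240, 221, 141, 021, 101, 120])
    (by decide +kernel)

theorem seeded_3_7_2 : Seeded 3 7 2 :=
  .of_list (digitPoints [
    000, 210, 020, 100, 121, 201, 011, 221, 240, 160, 141, 061, 251, 050, 260, 241, 220, 140,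
    161, 041, 060, 261, 051, 030, 150, 131, 110, 230, 211, 001, 200, 010, 031, 111, 130, 151,
    231, 250, 040, 021, 101, 120])
    (by decide +kernel)

theorem seeded_4_4_2 : Seeded 4 4 2 :=
  .of_list (digitPoints [
    000, 210, 330, 131, 321, 300, 220, 100, 020, 001, 200, 010, 031, 221, 301, 320, 121, 201,
    011, 030, 110, 311, 231, 111, 130, 331, 310, 230, 211, 021, 101, 120])
    (by decide +kernel)

theorem seeded_4_5_2 : Seeded 4 5 2 :=
  .of_list (digitPoints [
    000, 210, 011, 201, 321, 131, 211, 230, 031, 010, 200, 001, 020, 100, 301, 221, 341, 140,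
    330, 311, 121, 320, 240, 041, 231, 030, 110, 300, 101, 021, 040, 241, 220, 340, 130, 111,
    310, 331, 141, 120])
    (by decide +kernel)

theorem seeded_5_5_2 : Seeded 5 5 2 :=
  .of_list (digitPoints [
    000, 210, 400, 201, 011, 030, 220, 430, 411, 331, 141, 340, 130, 010, 200, 401, 321, 441,
    420, 300, 110, 311, 231, 041, 240, 320, 121, 140, 330, 131, 341, 421, 301, 221, 031, 111,
    310, 100, 020, 001, 211, 410, 431, 230, 440, 241, 040, 021, 101, 120])
    (by decide +kernel)

theorem seeded_3_3_4 : Seeded 3 3 4 :=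
  .of_list (digitPoints [
    000, 210, 112, 010, 200, 001, 020, 100, 220, 212, 011, 113, 211, 021, 222, 203, 013, 111,
    103, 023, 213, 003, 101, 221, 123, 102, 110, 012, 202, 122, 002, 201, 121, 223, 022, 120])
    (by decide +kernel)

theorem seeded_3_3_6 : Seeded 3 3 6 :=
  .of_list (digitPoints [
    000, 210, 020, 100, 220, 201, 121, 113, 011, 221, 123, 115, 213, 111, 103, 124, 204, 212,
    110, 102, 114, 012, 004, 025, 105, 225, 015, 205, 125, 104, 002, 203, 222, 023, 224, 122,
    202, 001, 211, 021, 101, 003, 022, 014, 215, 005, 013, 223, 024, 214, 112, 010, 200, 120])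
    (by decide +kernel)

/-- Boards of height `2`. For sides at least `4` the other side is cut into pieces of length
`3`, `4` and `5`; a `3 × 3 × 2` board having no tour, a board with a side `3` is cut into pieces
of length `4`, `5`, `6` and `7`. -/
theorem seeded_two {a b : ℕ} (ha : 3 ≤ a) (hb : 3 ≤ b) (hab : 4 ≤ a ∨ 4 ≤ b) :
    Seeded a b 2 := by
  have h3 : ∀ b : ℕ, 4 ≤ b → Seeded 3 b 2 := by
    intro b
    induction b using Nat.strong_induction_on with
    | _ b ih =>
      intro hb
      by_cases h : 8 ≤ b
      · have h1 := (ih (b - 4) (by omega) (by omega))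
        have := h1.add_right seeded_3_4_2 (by norm_num) (by omega) (by norm_num)
        rwa [show ((b - 4 : ℕ) : ℤ) + 4 = b by omega] at this
      · interval_cases b
        exacts [seeded_3_4_2, seeded_3_5_2, seeded_3_6_2, seeded_3_7_2]
  have h5 : ∀ b : ℕ, 3 ≤ b → ∀ a : ℤ, 3 ≤ a → Seeded a 3 2 → Seeded a 4 2 → Seeded a 5 2 →
      Seeded a b 2 := by
    intro b
    induction b using Nat.strong_induction_on with
    | _ b ih =>
      intro hb a ha k3 k4 k5
      by_cases h : 6 ≤ b
      · have h1 := (ih (b - 3) (by omega) (by omega)) a ha k3 k4 k5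
        have := h1.add_right k3 ha (by omega) (by norm_num)
        rwa [show ((b - 3 : ℕ) : ℤ) + 3 = b by omega] at this
      · interval_cases b
        exacts [k3, k4, k5]
  have h4 : ∀ b : ℕ, 3 ≤ b → Seeded 4 b 2 := fun b hb =>
    h5 b hb 4 (by norm_num) seeded_3_4_2.swap seeded_4_4_2 seeded_4_5_2
  have h5' : ∀ b : ℕ, 3 ≤ b → Seeded 5 b 2 := fun b hb =>
    h5 b hb 5 (by norm_num) seeded_3_5_2.swap seeded_4_5_2.swap seeded_5_5_2
  rcases Nat.lt_or_ge 3 b with h | h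
  · exact (h5 a ha b (by omega) (h3 b h).swap (h4 b hb).swap (h5' b hb).swap).swap
  · obtain rfl : b = 3 := by omega
    exact (h3 a (by omega)).swap

/-- A board of even height is a stack of boards of height `2`, unless its base is `3 × 3`; then it
is a stack of boards of heights `4` and `6`. -/
theorem seeded_even {a b c : ℕ} (ha : 3 ≤ a) (hb : 3 ≤ b) (hc : Even c) (hc2 : 2 ≤ c)
    (h : 4 ≤ a ∨ 4 ≤ b ∨ 4 ≤ c) : Seeded a b c := by
  by_cases hab : 4 ≤ a ∨ 4 ≤ b
  · obtain ⟨m, rfl⟩ := hc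
    have hm : 1 ≤ m := by omega
    clear h hc2
    induction m, hm using Nat.le_induction with
    | base => exact seeded_two ha hb hab
    | succ m hm ih =>
      have := ih.add_height (seeded_two ha hb hab) (by omega) (by omega) (by omega) (by omega)
      rwa [show ((m + m : ℕ) : ℤ) + 2 = (m + 1 + (m + 1) : ℕ) by push_cast; ring] at this
  · obtain rfl : a = 3 := by omega
    obtain rfl : b = 3 := by omega
    replace h : 4 ≤ c := by omega
    clear hc2
    induction c using Nat.strong_induction_on with
    | _ c ih =>
      by_cases h8 : 8 ≤ c
      · have h1 := ih (c - 4) (by omega) (by grind) (by omega)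
        have := h1.add_height seeded_3_3_4 (by norm_num) (by norm_num) (by omega) (by norm_num)
        rwa [show ((c - 4 : ℕ) : ℤ) + 4 = c by omega] at this
      · obtain rfl | rfl : c = 4 ∨ c = 6 := by grind
        exacts [seeded_3_3_4, seeded_3_3_6]

/-! ### Boards of arbitrary dimension -/

section Lattice

variable {ι : Type*}

/-- A knight move: one entry is `±1`, another one is `±2`, and all the others vanish. -/
def IsKnightMove (v : ι → ℤ) : Prop :=
  ∃ i j, i ≠ j ∧ (v i = 1 ∨ v i = -1) ∧ (v j = 2 ∨ v j = -2) ∧ ∀ l, l ≠ i → l ≠ j → v l = 0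

theorem IsKnightMove.neg {v : ι → ℤ} (h : IsKnightMove v) : IsKnightMove (-v) := by
  obtain ⟨i, j, hij, hi, hj, h⟩ := h
  refine ⟨i, j, hij, ?_, ?_, fun l hl hl' => ?_⟩
  · simp only [Pi.neg_apply]; omega
  · simp only [Pi.neg_apply]; omega
  · simp [h l hl hl']

/-- The knight graph on `ι → ℤ`. -/
def latticeKnight (ι : Type*) : SimpleGraph (ι → ℤ) where
  Adj u v := IsKnightMove (u - v)
  symm := ⟨fun u v h => by simpa using h.neg⟩
  loopless := ⟨fun u h => by
    obtain ⟨i, j, hij, hi, hj, h⟩ := h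
    simp at hi⟩

/-- The points of the board with side lengths `n`, with coordinates starting from `0`. -/
def latticeBox (n : ι → ℕ) : Set (ι → ℤ) :=
  {v | ∀ i, 0 ≤ v i ∧ v i < n i}

/-- Two points differ by exactly `±2`, and this in only one coordinate. -/
def TwoApart (u v : ι → ℤ) : Prop :=
  ∃ j, (u j - v j = 2 ∨ u j - v j = -2) ∧ ∀ l, l ≠ j → u l = v l

/-- The board with side lengths `n` has a closed tour with two disjoint pairs of distinct edges,
`s(x, y)`, `s(x', y')` and `s(z, w)`, `s(z', w')`, such that corresponding ends of the two edges
of each pair are two apart. If copies of the board are placed next to each other in a new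
direction, then `s(x, y)` in one copy and `s(x', y')` in the next can be exchanged for knight
moves between them. -/
def Extendable (n : ι → ℕ) : Prop :=
  ∃ x y x' y' z w z' w' : ι → ℤ,
    Tour (latticeKnight ι) (latticeBox n) {s(x, y), s(x', y'), s(z, w), s(z', w')} ∧
    TwoApart x x' ∧ TwoApart y y' ∧ TwoApart z z' ∧ TwoApart w w' ∧
    [s(x, y), s(x', y'), s(z, w), s(z', w')].Nodup

variable [DecidableEq ι]

/-- The translation by `t` in direction `d`. -/
def shift (d : ι) (t : ℤ) (v : ι → ℤ) : ι → ℤ :=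
  v + Pi.single d t

theorem shift_zero (d : ι) : shift d 0 = id := by
  ext v
  simp [shift]

theorem shift_self (d : ι) (t : ℤ) (v : ι → ℤ) : shift d t v d = v d + t := by
  simp [shift]

theorem shift_of_ne {d i : ι} (h : i ≠ d) (t : ℤ) (v : ι → ℤ) : shift d t v i = v i := by
  simp [shift, h]

theorem shift_injective (d : ι) (t : ℤ) : Function.Injective (shift d t) :=
  add_left_injective _

theorem TwoApart.shift {u v : ι → ℤ} (h : TwoApart u v) (d : ι) (t : ℤ) :
    TwoApart (shift d t u) (shift d t v) := by
  simpa [TwoApart, _root_.shift] using h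

/-- Points that are two apart within one layer become adjacent when one of them is moved to the
next layer. -/
theorem TwoApart.adj {u v : ι → ℤ} (h : TwoApart u v) {d : ι} (hd : u d = v d) {s t : ℤ}
    (hst : t = s + 1) : (latticeKnight ι).Adj (_root_.shift d s u) (_root_.shift d t v) := by
  obtain ⟨j, hj, h⟩ := h
  have hdj : d ≠ j := by rintro rfl; omega
  refine ⟨d, j, hdj, ?_, ?_, fun l hl hl' => ?_⟩
  · rw [Pi.sub_apply, shift_self, shift_self]; omega
  · rwa [Pi.sub_apply, shift_of_ne hdj.symm, shift_of_ne hdj.symm]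
  · rw [Pi.sub_apply, shift_of_ne hl, shift_of_ne hl, h l hl', sub_self]

/-- Edges inside different layers differ. -/
theorem eq_of_map_shift_eq {e e' : Sym2 (ι → ℤ)} {d : ι} (he : ∀ v ∈ e, v d = 0)
    (he' : ∀ v ∈ e', v d = 0) {s t : ℤ}
    (h : Sym2.map (shift d s) e = Sym2.map (shift d t) e') : s = t ∧ e = e' := by
  have hst : s = t := by
    induction e with
    | _ x y =>
      have hx : shift d s x ∈ Sym2.map (shift d t) e' := by rw [← h]; simp
      obtain ⟨w, hw, hwx⟩ := Sym2.mem_map.1 hx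
      have := congrFun hwx d
      rw [shift_self, shift_self, he' w hw, he x (by simp)] at this
      omega
  subst hst
  exact ⟨rfl, Sym2.map.injective (shift_injective d s) h⟩

theorem image_shift_latticeBox {n : ι → ℕ} {d : ι} (hd : n d = 1) (m : ℕ) :
    shift d m '' latticeBox n =
      {v | v ∈ latticeBox (Function.update n d (m + 1)) ∧ m ≤ v d} := by
  ext v
  constructor
  · rintro ⟨v, hv, rfl⟩
    have hvd := hv d
    refine ⟨fun i => ?_, by rw [shift_self]; omega⟩
    by_cases hi : i = d
    · subst hi
      rw [shift_self, Function.update_self]; push_cast; omega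
    · rw [shift_of_ne hi, Function.update_of_ne hi]; exact hv i
  · rintro ⟨hv, hm⟩
    refine ⟨shift d (-m) v, fun i => ?_, by simp [shift, add_assoc, ← Pi.single_add]⟩
    have := hv i
    by_cases hi : i = d
    · subst hi
      rw [Function.update_self] at this
      rw [shift_self]; push_cast at this; omega
    · rw [Function.update_of_ne hi] at this
      rwa [shift_of_ne hi]

/-- Copies of an extendable board, stacked in a new direction, are joined by means of the first
pair of edges, while every copy retains its second pair. -/
theorem Extendable.update {n : ι → ℕ} (h : Extendable n) {d : ι} (hd : n d = 1) {m : ℕ}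
    (hm : 2 ≤ m) : Extendable (Function.update n d m) := by
  obtain ⟨x, y, x', y', z, w, z', w', hT, hx, hy, hz, hw, hne⟩ := h
  set F : Set (Sym2 (ι → ℤ)) := {s(x, y), s(x', y'), s(z, w), s(z', w')} with hF
  have flat : ∀ e ∈ F, ∀ v ∈ e, v d = 0 := by
    intro e he v hv
    have := hT.mem he hv d
    omega
  have hx0 := flat s(x, y) (by simp [hF]) x (by simp)
  have hy0 := flat s(x, y) (by simp [hF]) y (by simp)
  have hx0' := flat s(x', y') (by simp [hF]) x' (by simp)
  have hy0' := flat s(x', y') (by simp [hF]) y' (by simp)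
  have flat' : ∀ e ∈ ({s(z, w), s(z', w')} : Set (Sym2 (ι → ℤ))), ∀ v ∈ e, v d = 0 :=
    fun e he => flat e (by simp only [hF, Set.mem_insert_iff, Set.mem_singleton_iff] at he ⊢; tauto)
  simp only [List.nodup_cons, List.mem_cons, List.not_mem_nil, or_false, not_or] at hne
  obtain ⟨⟨hxx, hxz, hxz'⟩, ⟨hxz₂, hxz₂'⟩, hzz, -⟩ := hne
  have copy : ∀ t : ℕ, Tour (latticeKnight ι) (shift d t '' latticeBox n)
      (Sym2.map (shift d t) '' F) := fun t =>
    hT.map _ (shift_injective d t).injOn fun u _ v _ huv => by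
      change IsKnightMove _
      rw [shift, shift, add_sub_add_right_eq_sub]
      exact huv
  have stack : ∀ t : ℕ, Tour (latticeKnight ι) (latticeBox (Function.update n d (t + 1)))
      ({Sym2.map (shift d t) s(x, y)} ∪ (Sym2.map (shift d (0 : ℕ)) '' {s(z, w), s(z', w')} ∪
        Sym2.map (shift d t) '' {s(z, w), s(z', w')})) := by
    intro t
    induction t with
    | zero =>
      rw [zero_add, ← hd, Function.update_eq_self]
      refine hT.mono ?_
      simp only [Nat.cast_zero, shift_zero, Set.union_self, Sym2.map_id, Set.image_id]
      rintro e (rfl | rfl | rfl) <;> simp [hF]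
    | succ t ih =>
      have hc := copy (t + 1)
      rw [image_shift_latticeBox hd] at hc
      have h4 := Tour.glue (x := shift d t x) (y := shift d t y)
        (x' := shift d (t + 1 : ℕ) x') (y' := shift d (t + 1 : ℕ) y') ih hc ?_ ?_ ?_
        (hx.adj (by omega) (by push_cast; rfl)) (hy.adj (by omega) (by push_cast; rfl))
      · have hbox : latticeBox (Function.update n d (t + 1)) ∪
            {v | v ∈ latticeBox (Function.update n d (t + 1 + 1)) ∧ ((t + 1 : ℕ) : ℤ) ≤ v d} =
            latticeBox (Function.update n d (t + 1 + 1)) := by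
          ext v
          have key : ∀ s : ℕ, v ∈ latticeBox (Function.update n d s) ↔
              (0 ≤ v d ∧ v d < s) ∧ ∀ i, i ≠ d → 0 ≤ v i ∧ v i < n i := by
            intro s
            constructor
            · refine fun hv => ⟨by simpa using hv d, fun i hi => by simpa [hi] using hv i⟩
            · rintro ⟨h1, h2⟩ i
              by_cases hi : i = d
              · subst hi; simpa using h1
              · simpa [hi] using h2 i hi
          simp only [Set.mem_union, Set.mem_ofPred_eq, key]
          push_cast
          constructor
          · rintro (h | h)
            · exact ⟨by omega, h.2⟩
            · exact h.1
          · intro h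
            by_cases hv : v d < t + 1
            · exact Or.inl ⟨by omega, h.2⟩
            · exact Or.inr ⟨h, by omega⟩
        rw [hbox] at h4
        refine h4.mono ?_
        rintro e (rfl | ⟨e, he, rfl⟩ | ⟨e, he, rfl⟩)
        · refine Or.inr ⟨⟨s(x, y), by simp [hF], rfl⟩, fun h => hxx ?_⟩
          exact (eq_of_map_shift_eq (flat _ (by simp [hF])) (e' := s(x', y'))
            (flat _ (by simp [hF])) h).2
        · refine Or.inl ⟨Or.inr (Or.inl ⟨e, he, rfl⟩), fun h => ?_⟩
          have := (eq_of_map_shift_eq (flat' e he) (e' := s(x, y)) (flat _ (by simp [hF])) h).2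
          rcases he with rfl | rfl
          exacts [hxz this.symm, hxz' this.symm]
        · refine Or.inr ⟨⟨e, ?_, rfl⟩, fun h => ?_⟩
          · simp only [hF, Set.mem_insert_iff, Set.mem_singleton_iff] at he ⊢
            tauto
          · have := (eq_of_map_shift_eq (flat' e he) (e' := s(x', y')) (flat _ (by simp [hF])) h).2
            rcases he with rfl | rfl
            exacts [hxz₂ this.symm, hxz₂' this.symm]
      · rw [Set.disjoint_left]
        rintro v hv ⟨_, hv'⟩
        have := hv d
        rw [Function.update_self] at this
        omega
      · exact Or.inl rfl
      · exact ⟨s(x', y'), by simp [hF], rfl⟩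
  obtain ⟨t, rfl⟩ : ∃ t, m = t + 1 := ⟨m - 1, by omega⟩
  refine ⟨_, _, _, _, _, _, _, _, (stack t).mono ?_, hz.shift d (0 : ℕ), hw.shift d (0 : ℕ),
    hz.shift d t, hw.shift d t, ?_⟩
  · rintro e (rfl | rfl | rfl | rfl)
    · exact Or.inr (Or.inl ⟨s(z, w), by simp, rfl⟩)
    · exact Or.inr (Or.inl ⟨s(z', w'), by simp, rfl⟩)
    · exact Or.inr (Or.inr ⟨s(z, w), by simp, rfl⟩)
    · exact Or.inr (Or.inr ⟨s(z', w'), by simp, rfl⟩)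
  · have ne : ∀ s t : ℕ, ∀ e ∈ ({s(z, w), s(z', w')} : Set (Sym2 (ι → ℤ))),
        ∀ e' ∈ ({s(z, w), s(z', w')} : Set (Sym2 (ι → ℤ))), (s ≠ t ∨ e ≠ e') →
        Sym2.map (shift d s) e ≠ Sym2.map (shift d t) e' := by
      intro s t e he e' he' hst h
      obtain ⟨h1, h2⟩ := eq_of_map_shift_eq (flat' e he) (flat' e' he') h
      exact hst.elim (fun h => h (by exact_mod_cast h1)) (fun h => h h2)
    have h0 : (0 : ℕ) ≠ t := by omega
    simp only [List.nodup_cons, List.mem_cons, List.not_mem_nil, or_false, not_or, not_false_iff,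
      List.nodup_nil, and_true]
    refine ⟨⟨ne 0 0 s(z, w) (by simp) s(z', w') (by simp) (Or.inr hzz),
      ne 0 t s(z, w) (by simp) s(z, w) (by simp) (Or.inl h0),
      ne 0 t s(z, w) (by simp) s(z', w') (by simp) (Or.inl h0)⟩,
      ⟨ne 0 t s(z', w') (by simp) s(z, w) (by simp) (Or.inl h0),
      ne 0 t s(z', w') (by simp) s(z', w') (by simp) (Or.inl h0)⟩,
      ne t t s(z, w) (by simp) s(z', w') (by simp) (Or.inr hzz)⟩

/-- If the sides of the board outside a set of directions are shrunk to `1` and the result is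
extendable, then so is the whole board: the other directions are restored one at a time. -/
theorem Extendable.of_restrict [Fintype ι] {n : ι → ℕ} (hn : ∀ i, 2 ≤ n i) (s : Finset ι)
    (h : Extendable fun i => if i ∈ s then n i else 1) : Extendable n := by
  have key : ∀ t : Finset ι, Extendable fun i => if i ∈ s ∪ t then n i else 1 := by
    intro t
    induction t using Finset.induction_on with
    | empty => simpa using h
    | insert d t _ ih =>
      by_cases hd : d ∈ s ∪ t
      · rwa [Finset.union_insert, Finset.insert_eq_of_mem hd]
      · have h1 := ih.update (d := d) (by simp only [if_neg hd]) (hn d)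
        convert h1 using 1
        ext i
        by_cases hi : i = d
        · subst hi; simp
        · simp [hi]
  simpa using key Finset.univ

/-- The embedding of `ℤ³` along the coordinates `p`, `q` and `r`. -/
def embed (p q r : ι) (v : ℤ × ℤ × ℤ) : ι → ℤ :=
  fun i => if i = p then v.1 else if i = q then v.2.1 else if i = r then v.2.2 else 0

theorem embed_injective {p q r : ι} (hpq : p ≠ q) (hpr : p ≠ r) (hqr : q ≠ r) :
    Function.Injective (embed p q r) := by
  intro u v h
  have h1 := congrFun h p
  have h2 := congrFun h q
  have h3 := congrFun h r
  simp only [embed, if_true, if_neg hpq.symm, if_neg hpr.symm, if_neg hqr.symm] at h1 h2 h3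
  ext
  exacts [h1, h2, h3]

theorem adj_embed {p q r : ι} (hpq : p ≠ q) (hpr : p ≠ r) (hqr : q ≠ r) {u v : ℤ × ℤ × ℤ}
    (h : spaceKnight.Adj u v) : (latticeKnight ι).Adj (embed p q r u) (embed p q r v) := by
  obtain ⟨x, y, z⟩ := u
  obtain ⟨x', y', z'⟩ := v
  change (x - x') ^ 2 + (y - y') ^ 2 + (z - z') ^ 2 = 5 at h
  have hp : (embed p q r (x, y, z) - embed p q r (x', y', z')) p = x - x' := by simp [embed]
  have hq : (embed p q r (x, y, z) - embed p q r (x', y', z')) q = y - y' := by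
    simp [embed, hpq.symm]
  have hr : (embed p q r (x, y, z) - embed p q r (x', y', z')) r = z - z' := by
    simp [embed, hpr.symm, hqr.symm]
  have h0 : ∀ i, i ≠ p → i ≠ q → i ≠ r →
      (embed p q r (x, y, z) - embed p q r (x', y', z')) i = 0 := by
    intro i h1 h2 h3
    simp [embed, h1, h2, h3]
  change IsKnightMove _
  generalize embed p q r (x, y, z) - embed p q r (x', y', z') = f at *
  rw [← hp, ← hq, ← hr] at h
  have b : ∀ t : ℤ, t ^ 2 ≤ 5 → t = -2 ∨ t = -1 ∨ t = 0 ∨ t = 1 ∨ t = 2 := by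
    intro t ht
    have h1 : -3 < t := by nlinarith
    have h2 : t < 3 := by nlinarith
    omega
  have build : ∀ i j k, (∀ l, l ≠ i → l ≠ j → l ≠ k → f l = 0) → i ≠ j →
      (f i = 1 ∨ f i = -1) → (f j = 2 ∨ f j = -2) → f k = 0 → IsKnightMove f := by
    intro i j k hl hij hi hj hk
    refine ⟨i, j, hij, hi, hj, fun l h1 h2 => ?_⟩
    by_cases h3 : l = k
    · exact h3 ▸ hk
    · exact hl l h1 h2 h3
  have b1 := b (f p) (by nlinarith [sq_nonneg (f q), sq_nonneg (f r)])
  have b2 := b (f q) (by nlinarith [sq_nonneg (f p), sq_nonneg (f r)])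
  have b3 := b (f r) (by nlinarith [sq_nonneg (f q), sq_nonneg (f p)])
  have cases3 : ((f p = 1 ∨ f p = -1) ∧ (f q = 2 ∨ f q = -2) ∧ f r = 0) ∨
      ((f p = 1 ∨ f p = -1) ∧ (f r = 2 ∨ f r = -2) ∧ f q = 0) ∨
      ((f q = 1 ∨ f q = -1) ∧ (f p = 2 ∨ f p = -2) ∧ f r = 0) ∨
      ((f q = 1 ∨ f q = -1) ∧ (f r = 2 ∨ f r = -2) ∧ f p = 0) ∨
      ((f r = 1 ∨ f r = -1) ∧ (f p = 2 ∨ f p = -2) ∧ f q = 0) ∨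
      ((f r = 1 ∨ f r = -1) ∧ (f q = 2 ∨ f q = -2) ∧ f p = 0) := by
    clear build h0 hp hq hr
    generalize f p = x at *
    generalize f q = y at *
    generalize f r = z at *
    rcases b1 with rfl | rfl | rfl | rfl | rfl <;> rcases b2 with rfl | rfl | rfl | rfl | rfl <;>
      rcases b3 with rfl | rfl | rfl | rfl | rfl <;> revert h <;> decide
  rcases cases3 with h | h | h | h | h | h
  · exact build p q r h0 hpq h.1 h.2.1 h.2.2
  · exact build p r q (fun l h1 h2 h3 => h0 l h1 h3 h2) hpr h.1 h.2.1 h.2.2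
  · exact build q p r (fun l h1 h2 h3 => h0 l h2 h1 h3) hpq.symm h.1 h.2.1 h.2.2
  · exact build q r p (fun l h1 h2 h3 => h0 l h3 h1 h2) hqr h.1 h.2.1 h.2.2
  · exact build r p q (fun l h1 h2 h3 => h0 l h2 h3 h1) hpr.symm h.1 h.2.1 h.2.2
  · exact build r q p (fun l h1 h2 h3 => h0 l h3 h2 h1) hqr.symm h.1 h.2.1 h.2.2

theorem Seeded.extendable {n : ι → ℕ} {p q r : ι} (hpq : p ≠ q) (hpr : p ≠ r) (hqr : q ≠ r)
    (h : Seeded (n p) (n q) (n r)) :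
    Extendable fun i => if i ∈ ({p, q, r} : Finset ι) then n i else 1 := by
  have h1 := h.map (embed p q r) (embed_injective hpq hpr hqr).injOn
    fun u _ v _ huv => adj_embed hpq hpr hqr huv
  have hbox : embed p q r '' (spaceBox (n p) (n q) (n r)) =
      latticeBox fun i => if i ∈ ({p, q, r} : Finset ι) then n i else 1 := by
    ext v
    constructor
    · rintro ⟨⟨x, y, z⟩, hv, rfl⟩ i
      rw [Finset.mem_coe, mem_spaceBox] at hv
      by_cases hip : i = p
      · subst hip; simpa [embed] using hv.1
      by_cases hiq : i = q
      · subst hiq; simpa [embed, hip] using hv.2.1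
      by_cases hir : i = r
      · subst hir; simpa [embed, hip, hiq] using hv.2.2
      · simp [embed, hip, hiq, hir]
    · intro hv
      refine ⟨(v p, v q, v r), ?_, ?_⟩
      · rw [Finset.mem_coe, mem_spaceBox]
        exact ⟨by simpa using hv p, by simpa using hv q, by simpa using hv r⟩
      · ext i
        have := hv i
        by_cases hip : i = p
        · simp [embed, hip]
        by_cases hiq : i = q
        · subst hiq; simp [embed, hip]
        by_cases hir : i = r
        · subst hir; simp [embed, hip, hiq]
        · simp only [Finset.mem_insert, Finset.mem_singleton, hip, hiq, hir, or_self,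
            if_false] at this
          simp only [embed, hip, hiq, hir, if_false]
          omega
  rw [hbox] at h1
  have apart : ∀ u v : ℤ × ℤ × ℤ, u.2.2 = 0 → v.2.2 = 0 →
      (u.1 - v.1 = 2 ∨ u.1 - v.1 = -2) ∧ u.2.1 = v.2.1 ∨
      (u.2.1 - v.2.1 = 2 ∨ u.2.1 - v.2.1 = -2) ∧ u.1 = v.1 →
      TwoApart (embed p q r u) (embed p q r v) := by
    rintro u v hu hv (⟨h1, h2⟩ | ⟨h1, h2⟩)
    · refine ⟨p, by simpa [embed] using h1, fun l hl => ?_⟩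
      simp [embed, hl, h2, hu, hv]
    · refine ⟨q, by simpa [embed, hpq.symm] using h1, fun l hl => ?_⟩
      simp [embed, hl, h2, hu, hv]
  refine ⟨embed p q r (0, 0, 0), embed p q r (1, 2, 0), embed p q r (0, 2, 0),
    embed p q r (1, 0, 0), embed p q r (0, 0, 0), embed p q r (2, 1, 0), embed p q r (2, 0, 0),
    embed p q r (0, 1, 0), h1.mono ?_, apart _ _ rfl rfl (by norm_num),
    apart _ _ rfl rfl (by norm_num),
    apart _ _ rfl rfl (by norm_num), apart _ _ rfl rfl (by norm_num), ?_⟩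
  · rintro e (rfl | rfl | rfl | rfl)
    · exact ⟨s((0, 0, 0), (1, 2, 0)), by simp [cornerEdges], rfl⟩
    · exact ⟨s((0, 2, 0), (1, 0, 0)), by simp [cornerEdges], rfl⟩
    · exact ⟨s((0, 0, 0), (2, 1, 0)), by simp [cornerEdges], rfl⟩
    · exact ⟨s((2, 0, 0), (0, 1, 0)), by simp [cornerEdges], rfl⟩
  · have : ([s((0, 0, 0), (1, 2, 0)), s((0, 2, 0), (1, 0, 0)), s((0, 0, 0), (2, 1, 0)),
        s((2, 0, 0), (0, 1, 0))] : List (Sym2 (ℤ × ℤ × ℤ))).Nodup := by decide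
    simpa using this.map (Sym2.map.injective (embed_injective hpq hpr hqr))

end Lattice

/-! ### Closed tours of the knight graph of a board -/

theorem mem_knightMoves_iff {k : ℕ} {v : Fin k → ℤ} : v ∈ knightMoves k ↔ IsKnightMove v := by
  constructor
  · rintro ⟨h0, h1, h2⟩
    obtain ⟨i, hi⟩ := Finset.card_eq_one.1 h1
    obtain ⟨j, hj⟩ := Finset.card_eq_one.1 h2
    have hi' : v i = 1 ∨ v i = -1 := by
      have : i ∈ ({i} : Finset (Fin k)) := by simp
      rw [← hi] at this
      simpa using this
    have hj' : v j = 2 ∨ v j = -2 := by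
      have : j ∈ ({j} : Finset (Fin k)) := by simp
      rw [← hj] at this
      simpa using this
    have hij : i ≠ j := by rintro rfl; omega
    refine ⟨i, j, hij, hi', hj', fun l hl hl' => ?_⟩
    -- The zero entries are as numerous as the positions other than `i` and `j`.
    have hsub : (Finset.univ.filter fun i => v i = 0) ⊆ Finset.univ \ {i, j} := by
      intro l hl
      simp only [Finset.mem_filter, Finset.mem_univ, true_and] at hl
      simp only [Finset.mem_sdiff, Finset.mem_univ, true_and, Finset.mem_insert,
        Finset.mem_singleton, not_or]
      constructor <;> (rintro rfl; omega)
    have hcard : (Finset.univ \ {i, j} : Finset (Fin k)).card + 2 = k := by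
      rw [Finset.card_sdiff_of_subset (Finset.subset_univ _), Finset.card_pair hij,
        Finset.card_univ, Fintype.card_fin]
      have := Finset.card_le_univ ({i, j} : Finset (Fin k))
      rw [Finset.card_pair hij, Fintype.card_fin] at this
      omega
    have heq := Finset.eq_of_subset_of_card_le hsub (by omega)
    have : l ∈ (Finset.univ \ {i, j} : Finset (Fin k)) := by simp [hl, hl']
    rw [← heq] at this
    simpa using this
  · rintro ⟨i, j, hij, hi, hj, h⟩
    have h1 : (Finset.univ.filter fun l => v l = 1 ∨ v l = -1) = {i} := by
      ext l
      simp only [Finset.mem_filter, Finset.mem_univ, true_and, Finset.mem_singleton]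
      refine ⟨fun hl => ?_, fun hl => hl ▸ hi⟩
      by_contra hne
      by_cases hlj : l = j
      · subst hlj; omega
      · have := h l hne hlj; omega
    have h2 : (Finset.univ.filter fun l => v l = 2 ∨ v l = -2) = {j} := by
      ext l
      simp only [Finset.mem_filter, Finset.mem_univ, true_and, Finset.mem_singleton]
      refine ⟨fun hl => ?_, fun hl => hl ▸ hj⟩
      by_contra hne
      by_cases hli : l = i
      · subst hli; omega
      · have := h l hli hne; omega
    have h0 : (Finset.univ.filter fun l => v l = 0) = Finset.univ \ {i, j} := by
      ext l
      simp only [Finset.mem_filter, Finset.mem_univ, true_and, Finset.mem_sdiff,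
        Finset.mem_insert, Finset.mem_singleton, not_or]
      refine ⟨fun hl => ⟨?_, ?_⟩, fun hl => h l hl.1 hl.2⟩ <;> (rintro rfl; omega)
    refine ⟨?_, by rw [h1]; rfl, by rw [h2]; rfl⟩
    have := Finset.card_le_univ ({i, j} : Finset (Fin k))
    rw [Finset.card_pair hij, Fintype.card_fin] at this
    rw [h0, Finset.card_sdiff_of_subset (Finset.subset_univ _), Finset.card_pair hij,
      Finset.card_univ, Fintype.card_fin]
    omega

theorem isChain_of_pathEdges {V : Type*} {G : SimpleGraph V} {l : List V}
    (h : ∀ e ∈ pathEdges l, e ∈ G.edgeSet) : l.IsChain G.Adj := by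
  induction l with
  | nil => simp
  | cons a l ih =>
    cases l with
    | nil => simp
    | cons b l =>
      rw [List.isChain_cons_cons]
      exact ⟨h s(a, b) (by simp [pathEdges]), ih fun e he => h e (by simp [pathEdges, he])⟩

/-- A list of consecutively adjacent vertices with prescribed ends is traced by a walk. -/
theorem exists_walk_support {V : Type*} {G : SimpleGraph V} {a b : V} {l : List V}
    (h : (a :: l ++ [b]).IsChain G.Adj) : ∃ p : G.Walk a b, p.support = a :: l ++ [b] := by
  induction l generalizing a with
  | nil => exact ⟨.cons (by simpa using h) .nil, by simp⟩
  | cons c l ih =>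
    rw [List.cons_append, List.cons_append, List.isChain_cons_cons] at h
    obtain ⟨p, hp⟩ := ih h.2
    exact ⟨.cons h.1 p, by simp [hp]⟩

theorem Tour.exists_isHamiltonianCycle {V : Type*} [Fintype V] [DecidableEq V]
    {G : SimpleGraph V} {F : Set (Sym2 V)} (h : Tour G Set.univ F) (hV : 3 ≤ Fintype.card V) :
    ∃ (a : V) (p : G.Walk a a), p.IsHamiltonianCycle := by
  obtain ⟨l, nd, mem, adj, -⟩ := h
  have hlen : l.length = Fintype.card V := by
    rw [← List.toFinset_card_of_nodup nd, ← Finset.card_univ]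
    congr 1
    ext v
    simp [mem]
  cases l with
  | nil => simp at hlen; omega
  | cons a t =>
    obtain ⟨p, hp⟩ := exists_walk_support (isChain_of_pathEdges adj)
    have hpl : p.length = Fintype.card V := by
      have := p.length_support
      rw [hp] at this
      simp at this hlen
      omega
    refine ⟨a, p, SimpleGraph.Walk.isHamiltonianCycle_iff_isCycle_and_length_eq.2 ⟨?_, hpl⟩⟩
    refine SimpleGraph.Walk.isCycle_iff_isPath_tail_and_le_length.2 ⟨?_, by omega⟩
    have hnil : ¬ p.Nil := by
      rw [← SimpleGraph.Walk.length_eq_zero_iff]; omega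
    rw [SimpleGraph.Walk.isPath_def, SimpleGraph.Walk.support_tail_of_not_nil _ hnil, hp]
    simpa using (List.perm_append_singleton a t).nodup_iff.2 nd

theorem Extendable.hasClosedTour {k : ℕ} (hk : 2 ≤ k) {n : Fin k → ℕ} (hn : ∀ i, 2 ≤ n i)
    (h : Extendable n) : HasClosedTour n := by
  obtain ⟨x, y, x', y', z, w, z', w', hT, -⟩ := h
  let f : (Fin k → ℤ) → Board n := fun v i =>
    if hi : (v i).toNat < n i then ⟨(v i).toNat, hi⟩ else ⟨0, by have := hn i; omega⟩
  have hf : ∀ v ∈ latticeBox n, ∀ i, ((f v i : ℕ) : ℤ) = v i := by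
    intro v hv i
    have := hv i
    have hlt : (v i).toNat < n i := by omega
    simp only [f, dif_pos hlt]
    omega
  have h1 := hT.map (H := knightGraph n) f
    (fun u hu v hv huv => by ext i; rw [← hf u hu, ← hf v hv, huv])
    (fun u hu v hv huv => by
      change _ ∈ knightMoves k
      rw [mem_knightMoves_iff]
      have : (fun i => ((f u i : ℕ) : ℤ) - ((f v i : ℕ) : ℤ)) = u - v := by
        ext i; rw [hf u hu, hf v hv]; rfl
      rw [this]
      exact huv)
  have h2 : f '' latticeBox n = Set.univ := by
    refine Set.eq_univ_of_forall fun b => ?_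
    have hb : (fun i => ((b i : ℕ) : ℤ)) ∈ latticeBox n := fun i => by
      have := (b i).isLt
      dsimp only
      omega
    refine ⟨_, hb, ?_⟩
    ext i
    have := hf _ hb i
    exact_mod_cast this
  rw [h2] at h1
  refine h1.exists_isHamiltonianCycle ?_
  have : 2 ^ k ≤ ∏ i, n i := by
    simpa using Finset.prod_le_prod' fun i (_ : i ∈ Finset.univ) => hn i
  have h4 : 2 ^ 2 ≤ 2 ^ k := Nat.pow_le_pow_right (by norm_num) hk
  simp only [Fintype.card_pi, Fintype.card_fin]
  omega

/-! ### Boards without closed tours -/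

section Nonexistence

variable {k : ℕ} {n : Fin k → ℕ}

theorem exists_of_adj {a b : Board n} (h : (knightGraph n).Adj a b) :
    ∃ i j, i ≠ j ∧
      (((a i : ℕ) : ℤ) - ((b i : ℕ) : ℤ) = 1 ∨ ((a i : ℕ) : ℤ) - ((b i : ℕ) : ℤ) = -1) ∧
      (((a j : ℕ) : ℤ) - ((b j : ℕ) : ℤ) = 2 ∨ ((a j : ℕ) : ℤ) - ((b j : ℕ) : ℤ) = -2) ∧
      ∀ l, l ≠ i → l ≠ j → ((a l : ℕ) : ℤ) - ((b l : ℕ) : ℤ) = 0 :=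
  mem_knightMoves_iff.1 h

/-- A knight move changes the parity of the coordinate sum, so a board with a closed tour has an
even number of squares. -/
theorem HasClosedTour.exists_even (h : HasClosedTour n) : ∃ i, ¬ Odd (n i) := by
  by_contra! hodd
  obtain ⟨a, p, hp⟩ := h
  have hadj : ∀ a b : Board n, (knightGraph n).Adj a b →
      (∑ i, ((a i : ℕ) : ℤ)) % 2 ≠ (∑ i, ((b i : ℕ) : ℤ)) % 2 := by
    intro a b hab
    obtain ⟨i, j, hij, hi, hj, h⟩ := exists_of_adj hab
    have hs : ∑ l, (((a l : ℕ) : ℤ) - ((b l : ℕ) : ℤ)) =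
        (((a i : ℕ) : ℤ) - ((b i : ℕ) : ℤ)) + (((a j : ℕ) : ℤ) - ((b j : ℕ) : ℤ)) := by
      rw [← Finset.sum_pair (f := fun l => ((a l : ℕ) : ℤ) - ((b l : ℕ) : ℤ)) hij]
      symm
      apply Finset.sum_subset (Finset.subset_univ _)
      intro l _ hl
      simp only [Finset.mem_insert, Finset.mem_singleton, not_or] at hl
      exact h l hl.1 hl.2
    rw [Finset.sum_sub_distrib] at hs
    omega
  let c : (knightGraph n).Coloring Bool :=
    SimpleGraph.Coloring.mk (fun a => decide ((∑ i, ((a i : ℕ) : ℤ)) % 2 = 0)) (by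
      intro a b hab heq
      have := hadj a b hab
      rw [decide_eq_decide] at heq
      omega)
  have heven : Even p.length := (c.even_length_iff_congr p).2 Iff.rfl
  rw [hp.length_eq, Fintype.card_pi] at heven
  simp only [Fintype.card_fin] at heven
  rw [← Nat.not_odd_iff_even] at heven
  exact heven (Finset.prod_induction _ Odd (fun _ _ => Odd.mul) odd_one fun i _ => hodd i)

theorem HasClosedTour.reachable (h : HasClosedTour n) (u v : Board n) :
    (knightGraph n).Reachable u v := by
  obtain ⟨a, p, hp⟩ := h
  have (b : Board n) : (knightGraph n).Reachable a b := ⟨p.takeUntil b (hp.mem_support b)⟩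
  exact (this u).symm.trans (this v)

/-- If all sides but one have length at most `2`, the `±2` of each move is in the exceptional
direction, whose coordinate therefore keeps its parity. -/
theorem not_hasClosedTour_of_le_two (j : Fin k) (hn : ∀ i, 2 ≤ n i) (h : ∀ i, i ≠ j → n i ≤ 2) :
    ¬ HasClosedTour n := by
  intro ht
  let u : Board n := fun i => ⟨0, by have := hn i; omega⟩
  let v : Board n := fun i => ⟨1, by have := hn i; omega⟩
  have key : ∀ a b : Board n, (knightGraph n).Walk a b → (a j : ℕ) % 2 = (b j : ℕ) % 2 := by
    intro a b p
    induction p with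
    | nil => rfl
    | cons hab _ ih =>
      rw [← ih]
      obtain ⟨i, j', hij, hi, hj, h'⟩ := exists_of_adj hab
      obtain rfl : j' = j := by
        by_contra hne
        rename_i a b _ _
        have h1 := (a j').isLt
        have h2 := (b j').isLt
        have h3 := h j' hne
        omega
      omega
  obtain ⟨p⟩ := ht.reachable u v
  have := key u v p
  simp [u, v] at this

/-- If all sides have length at most `3`, no move is possible from the square with all
coordinates `1`. -/
theorem not_hasClosedTour_of_le_three (hk : 0 < k) (hn : ∀ i, 2 ≤ n i) (h : ∀ i, n i ≤ 3) :
    ¬ HasClosedTour n := by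
  intro ht
  let u : Board n := fun i => ⟨1, by have := hn i; omega⟩
  let v : Board n := fun i => ⟨0, by have := hn i; omega⟩
  obtain ⟨p⟩ := ht.reachable u v
  cases hp : p.length with
  | zero =>
    have := congrFun (SimpleGraph.Walk.eq_of_length_eq_zero hp) ⟨0, hk⟩
    simp [u, v] at this
  | succ m =>
    have hnil : ¬ p.Nil := by rw [← SimpleGraph.Walk.length_eq_zero_iff]; omega
    obtain ⟨i, j, -, -, hj, -⟩ := exists_of_adj (p.adj_snd hnil)
    have h1 := (p.snd j).isLt
    have h2 := h j
    have h3 : ((u j : ℕ) : ℤ) = 1 := rfl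
    omega

end Nonexistence

/-! ### The classification -/

theorem theorem1p3 (k : ℕ) (hk : 3 ≤ k) (n : Fin k → ℕ) (hn : ∀ i, 2 ≤ n i)
    (hmono : Monotone n) :
    ¬ HasClosedTour n ↔
      (∀ i, Odd (n i)) ∨ n ⟨k - 2, by omega⟩ = 2 ∨ n ⟨k - 1, by omega⟩ = 3 := by
  constructor
  · contrapose!
    rintro ⟨⟨i, hi⟩, h2, h3⟩
    rw [Nat.not_odd_iff_even] at hi
    have hq : 3 ≤ n ⟨k - 2, by omega⟩ := by have := hn ⟨k - 2, by omega⟩; omega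
    have hpq : n ⟨k - 2, by omega⟩ ≤ n ⟨k - 1, by omega⟩ :=
      hmono (Fin.mk_le_mk.2 (by omega))
    have of_roles : ∀ p q r : Fin k, p ≠ q → p ≠ r → q ≠ r → 3 ≤ n p → 3 ≤ n q → Even (n r) →
        (4 ≤ n p ∨ 4 ≤ n q ∨ 4 ≤ n r) → HasClosedTour n := fun p q r h1 h2 h3 hp hq hr h4 =>
      (Extendable.of_restrict hn _ ((seeded_even hp hq hr (hn r) h4).extendable
        h1 h2 h3)).hasClosedTour (by omega) hn
    by_cases hlow : ∃ r : Fin k, (r : ℕ) < k - 2 ∧ Even (n r)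
    · obtain ⟨r, hr, hr'⟩ := hlow
      exact of_roles ⟨k - 2, by omega⟩ ⟨k - 1, by omega⟩ r (by simp; omega)
        (by rw [Ne, Fin.ext_iff]; simp; omega) (by rw [Ne, Fin.ext_iff]; simp; omega) hq
        (by omega) hr' (by omega)
    · -- All sides but the last two are odd, so the third largest is at least `3` as well.
      push Not at hlow
      have hodd := hlow ⟨k - 3, by omega⟩ (by simp; omega)
      have h2k := hn ⟨k - 3, by omega⟩
      have hr : 3 ≤ n ⟨k - 3, by omega⟩ := by
        rcases Nat.lt_or_ge 2 (n ⟨k - 3, by omega⟩) with h | h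
        · exact h
        · exact absurd (by rw [show n ⟨k - 3, by omega⟩ = 2 by omega]; exact even_two) hodd
      have hi' : (i : ℕ) = k - 2 ∨ (i : ℕ) = k - 1 := by
        by_contra! hc
        exact hlow i (by omega) hi
      rcases hi' with h | h
      · rw [show i = ⟨k - 2, by omega⟩ from Fin.ext h] at hi
        have := Nat.even_iff.1 hi
        exact of_roles ⟨k - 3, by omega⟩ ⟨k - 1, by omega⟩ ⟨k - 2, by omega⟩ (by simp; omega)
          (by simp; omega) (by simp; omega) hr (by omega) hi (by omega)
      · rw [show i = ⟨k - 1, by omega⟩ from Fin.ext h] at hi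
        have := Nat.even_iff.1 hi
        exact of_roles ⟨k - 3, by omega⟩ ⟨k - 2, by omega⟩ ⟨k - 1, by omega⟩ (by simp; omega)
          (by simp; omega) (by simp; omega) hr hq hi (by omega)
  · rintro (h | h | h) ht
    · obtain ⟨i, hi⟩ := ht.exists_even
      exact hi (h i)
    · refine not_hasClosedTour_of_le_two ⟨k - 1, by omega⟩ hn (fun i hi => ?_) ht
      rw [← h]
      refine hmono (Fin.mk_le_mk.2 ?_)
      have : (i : ℕ) ≠ k - 1 := fun h => hi (Fin.ext h)
      omega
    · refine not_hasClosedTour_of_le_three (by omega) hn (fun i => ?_) ht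
      rw [← h]
      exact hmono (Fin.mk_le_mk.2 (by omega))
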